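/- Conventions. For $n\ge 1$ let $\mathcal M_n^{sa}$ be the set of Hermitian complex $n\times n$ matrices, and let $\le$ be the Loewner order. A free set $\mathcal F$ in $g$ variables is a family of sets $\mathcal F_n\subseteq(\mathcal M_n^{sa})^g$, $n\ge 1$. Its polar dual $\mathcal F^\bullet$ has levels $$\mathcal F^\bullet_n=\Big\{X\in(\mathcal M_n^{sa})^g:\ \sum_{i=1}^g A_i\otimes X_i\le I\ \text{ for all } m\ge 1 \text{ and all } A\in\mathcal F_m\Big\}.$$ Let $\mathcal F\otimes I$ be the free set with $(\mathcal F\otimes I)_{n^2}=\{(X_1\otimes I_n,\dots,X_g\otimes I_n):X\in\mathcal F_n\}$ for $n\ge1$ and all other levels empty; $I\otimes\mathcal F$ is defined analogously with $I_n\otimes X_i$. The Cartesian product of free sets is taken levelwise, $(\mathcal F\,\hat\times\,\mathcal G)_n=\{(X,Y):X\in\mathcal F_n,\ Y\in\mathcal G_n\}$, and the direct sum of $\mathcal F$ and $\mathcal G$ is $$\mathcal F\,\hat\oplus\,\mathcal G=\big((\mathcal F^\bullet\otimes I)\,\hat\times\,(I\otimes\mathcal G^\bullet)\big)^\bullet .$$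 For a tuple $A=(A_1,\dots,A_g)$ of bounded self-adjoint operators on a complex Hilbert space $\mathcal H$, the free spectrahedron $\mathcal D_A$ is the free set with levels $$\mathcal D_A(n)=\Big\{X\in(\mathcal M_n^{sa})^g:\ \sum_{i=1}^g A_i\otimes X_i\le I_{\mathcal H}\otimes I_n\Big\}.$$ Level one of a free set is regarded as a subset of $\mathbb R^g$. For convex sets $P\subseteq\mathbb R^{k_1}$ and $Q\subseteq\mathbb R^{k_2}$, the ordinary direct sum is $P\oplus Q=\mathrm{conv}\big((P\times\{0\})\cup(\{0\}\times Q)\big)\subseteq\mathbb R^{k_1+k_2}$. A polytope is the convex hull of finitely many points. Proposition. Let $k_1,k_2\ge 1$, let $\mathcal H_1,\mathcal H_2$ be complex Hilbert spaces, and let $A=(A_1,\dots,A_{k_1})$ and $B=(B_1,\dots,B_{k_2})$ be tuples of bounded self-adjoint operators on $\mathcal H_1$ and $\mathcal H_2$, respectively. Assume that $\mathcal D_A(1)$ and $\mathcal D_B(1)$ are bounded. Then $\mathcal D_A\,\hat\oplus\,\mathcal D_B$ is the free spectrahedron defined by the self-adjoint tuple $(A\otimes I_{\mathcal H_2},\,I_{\mathcal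 H_1}\otimes B)$ on the Hilbert space tensor product $\mathcal H_1\otimes\mathcal H_2$; that is, for every $n\ge1$, $$(\mathcal D_A\,\hat\oplus\,\mathcal D_B)(n)=\Big\{X\in(\mathcal M_n^{sa})^{k_1+k_2}:\ \sum_{i=1}^{k_1}(A_i\otimes I_{\mathcal H_2})\otimes X_i+\sum_{j=1}^{k_2}(I_{\mathcal H_1}\otimes B_j)\otimes X_{k_1+j}\le I_{\mathcal H_1\otimes\mathcal H_2}\otimes I_n\Big\}.$$ If moreover $\mathcal D_A(1)$ and $\mathcal D_B(1)$ are polytopes, then $(\mathcal D_A\,\hat\oplus\,\mathcal D_B)(1)=\mathcal D_A(1)\oplus\mathcal D_B(1)$. -/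

import Mathlib

open scoped TensorProduct Kronecker ComplexOrder

noncomputable section

namespace FreeSpectra

section OperatorTensor

/-- The Hilbert space tensor product: the completion of the algebraic tensor product for the
inner product with `⟪a ⊗ b, c ⊗ d⟫ = ⟪a, c⟫ * ⟪b, d⟫`. -/
abbrev HilbertTensor (H K : Type*) [NormedAddCommGroup H] [InnerProductSpace ℂ H]
    [NormedAddCommGroup K] [InnerProductSpace ℂ K] : Type _ :=
  UniformSpace.Completion (H ⊗[ℂ] K)

variable {H K : Type*} [NormedAddCommGroup H] [InnerProductSpace ℂ H]
  [NormedAddCommGroup K] [InnerProductSpace ℂ K]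

/-- The tensor product `S ⊗ T` of two bounded operators, as a bounded operator on the Hilbert space
tensor product: the continuous extension of `a ⊗ b ↦ S a ⊗ T b`. -/
def opTensor (S : H →L[ℂ] H) (T : K →L[ℂ] K) : HilbertTensor H K →L[ℂ] HilbertTensor H K :=
  ((UniformSpace.Completion.toComplL : (H ⊗[ℂ] K) →L[ℂ] HilbertTensor H K).comp
    (TensorProduct.mapL S T)).extend UniformSpace.Completion.toComplL

theorem opTensor_coe (S : H →L[ℂ] H) (T : K →L[ℂ] K) (x : H ⊗[ℂ] K) :
    opTensor S T (x : HilbertTensor H K) =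
      ((TensorProduct.mapL S T x : H ⊗[ℂ] K) : HilbertTensor H K) :=
  ContinuousLinearMap.extend_eq _ (e := UniformSpace.Completion.toComplL)
    UniformSpace.Completion.denseRange_coe
    (UniformSpace.Completion.isUniformInducing_coe (H ⊗[ℂ] K)) x

end OperatorTensor

/-- A free set in `g` variables: for every `n ≥ 1` a set of `g`-tuples of Hermitian complex
`n × n` matrices. -/
@[ext]
structure FreeSet (g : ℕ) where
  /-- The `n`-th level. -/
  level : (n : ℕ+) → Set (Fin g → Matrix (Fin n) (Fin n) ℂ)
  isHermitian : ∀ (n : ℕ+), ∀ X ∈ level n, ∀ i, (X i).IsHermitian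

/-- The free spectrahedron of `A = (A₁, …, A_g)`: level `n` is the set of all Hermitian tuples `X`
with `∑ Aᵢ ⊗ Xᵢ ≤ I` (Loewner order) as operators on `H ⊗ ℂⁿ`. As `ℂⁿ` is finite-dimensional,
the algebraic tensor product is already the Hilbert space tensor product here. -/
def freeSpectrahedron {H : Type*} [NormedAddCommGroup H] [InnerProductSpace ℂ H] {g : ℕ}
    (A : Fin g → H →L[ℂ] H) : FreeSet g where
  level n := {X | (∀ i, (X i).IsHermitian) ∧
    ∑ i, TensorProduct.mapL (A i) (Matrix.toEuclideanCLM (n := Fin n) (𝕜 := ℂ) (X i)) ≤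
      ContinuousLinearMap.id ℂ (H ⊗[ℂ] EuclideanSpace ℂ (Fin n))}
  isHermitian _ _ hX := hX.1

/-- The concatenated tuple `(A ⊗ I, I ⊗ B)` on the Hilbert space tensor product. -/
def tensorTuple {H K : Type*} [NormedAddCommGroup H] [InnerProductSpace ℂ H]
    [NormedAddCommGroup K] [InnerProductSpace ℂ K] {k₁ k₂ : ℕ}
    (A : Fin k₁ → H →L[ℂ] H) (B : Fin k₂ → K →L[ℂ] K) :
    Fin (k₁ + k₂) → HilbertTensor H K →L[ℂ] HilbertTensor H K :=
  Fin.append (fun i => opTensor (A i) (ContinuousLinearMap.id ℂ K))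
    (fun j => opTensor (ContinuousLinearMap.id ℂ H) (B j))

/-- The polar dual of a free set: level `n` is the set of all Hermitian tuples `X` such that
`∑ Aᵢ ⊗ Xᵢ ≤ I` for all tuples `A` in any level of `F`. -/
def FreeSet.polar {g : ℕ} (F : FreeSet g) : FreeSet g where
  level n := {X | (∀ i, (X i).IsHermitian) ∧
    ∀ m : ℕ+, ∀ A ∈ F.level m, (1 - ∑ i, A i ⊗ₖ X i).PosSemidef}
  isHermitian _ _ hX := hX.1

/-- The Cartesian product of free sets, taken level by level. -/
def FreeSet.prod {g₁ g₂ : ℕ} (F : FreeSet g₁) (G : FreeSet g₂) : FreeSet (g₁ + g₂) where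
  level n := {Z | ∃ X ∈ F.level n, ∃ Y ∈ G.level n, Z = Fin.append X Y}
  isHermitian := by
    rintro n _ ⟨X, hX, Y, hY, rfl⟩ i
    refine Fin.addCases (fun j => ?_) (fun j => ?_) i
    · rw [Fin.append_left]; exact F.isHermitian n X hX j
    · rw [Fin.append_right]; exact G.isHermitian n Y hY j

/-- The Kronecker product of two `n × n` matrices, with rows and columns indexed by `Fin m`, where
`m = n²`, in the usual (lexicographic) order. -/
def kronSq {n m : ℕ} (h : n * n = m) (X Y : Matrix (Fin n) (Fin n) ℂ) :
    Matrix (Fin m) (Fin m) ℂ :=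
  Matrix.reindex (finProdFinEquiv.trans (finCongr h)) (finProdFinEquiv.trans (finCongr h)) (X ⊗ₖ Y)

theorem kronSq_isHermitian {n m : ℕ} (h : n * n = m) {X Y : Matrix (Fin n) (Fin n) ℂ}
    (hX : X.IsHermitian) (hY : Y.IsHermitian) : (kronSq h X Y).IsHermitian := by
  have hXY : (X ⊗ₖ Y).IsHermitian := by
    rw [Matrix.IsHermitian, Matrix.conjTranspose_kronecker, hX.eq, hY.eq]
  exact hXY.submatrix _

/-- The free set `F ⊗ I`: level `n²` is `{(X₁ ⊗ Iₙ, …, X_g ⊗ Iₙ) : X ∈ Fₙ}`, and the levels that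
are not squares are empty. -/
def FreeSet.tensorOne {g : ℕ} (F : FreeSet g) : FreeSet g where
  level m := {Z | ∃ (n : ℕ+) (h : (n : ℕ) * n = m), ∃ X ∈ F.level n, Z = fun i => kronSq h (X i) 1}
  isHermitian := by
    rintro m _ ⟨n, h, X, hX, rfl⟩ i
    exact kronSq_isHermitian h (F.isHermitian n X hX i) Matrix.isHermitian_one

/-- The free set `I ⊗ F`: level `n²` is `{(Iₙ ⊗ X₁, …, Iₙ ⊗ X_g) : X ∈ Fₙ}`, and the levels that
are not squares are empty. -/
def FreeSet.oneTensor {g : ℕ} (F : FreeSet g) : FreeSet g where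
  level m := {Z | ∃ (n : ℕ+) (h : (n : ℕ) * n = m), ∃ X ∈ F.level n, Z = fun i => kronSq h 1 (X i)}
  isHermitian := by
    rintro m _ ⟨n, h, X, hX, rfl⟩ i
    exact kronSq_isHermitian h Matrix.isHermitian_one (F.isHermitian n X hX i)

/-- The direct sum of matrix convex sets: the polar dual of `(F^• ⊗ I) × (I ⊗ G^•)`. -/
def FreeSet.directSum {g₁ g₂ : ℕ} (F : FreeSet g₁) (G : FreeSet g₂) : FreeSet (g₁ + g₂) :=
  (F.polar.tensorOne.prod G.polar.oneTensor).polar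

/-- Level one of a free set, as a subset of `ℝ^g`: Hermitian `1 × 1` matrices are identified with
real numbers. -/
def FreeSet.levelOne {g : ℕ} (F : FreeSet g) : Set (Fin g → ℝ) :=
  {x | (fun i => Matrix.of fun _ _ => (x i : ℂ)) ∈ F.level 1}

/-- A polytope: the convex hull of finitely many points. -/
def IsPolytope {k : ℕ} (P : Set (Fin k → ℝ)) : Prop :=
  ∃ S : Finset (Fin k → ℝ), P = convexHull ℝ (S : Set (Fin k → ℝ))

/-- The ordinary direct sum of convex sets `P ⊆ ℝ^{k₁}`, `Q ⊆ ℝ^{k₂}`: the convex hull of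
`(P × {0}) ∪ ({0} × Q)` in `ℝ^{k₁ + k₂}`. -/
def convexDirectSum {k₁ k₂ : ℕ} (P : Set (Fin k₁ → ℝ)) (Q : Set (Fin k₂ → ℝ)) :
    Set (Fin (k₁ + k₂) → ℝ) :=
  convexHull ℝ ({z | ∃ x ∈ P, z = Fin.append x 0} ∪ {z | ∃ y ∈ Q, z = Fin.append 0 y})

end FreeSpectra

end

open scoped TensorProduct Kronecker ComplexOrder InnerProductSpace

noncomputable section

namespace FreeSpectra

variable {H K : Type*} [NormedAddCommGroup H] [InnerProductSpace ℂ H]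
  [NormedAddCommGroup K] [InnerProductSpace ℂ K]

/-! Unfolding the polar, `X` lies in the direct sum iff `1 ⊗ 1 ⊗ 1 - ∑ Cᵢ ⊗ 1 ⊗ Xᵢ - ∑ 1 ⊗ Dⱼ ⊗
X_{k₁+j}` is positive for all `C`, `D` of equal size in the polars of the two spectrahedra
(`mem_directSum_iff`). The theorem says that `C`, `D` may be traded for `A`, `B`.

From matrices to operators: the compression of `A` to finitely many vectors, normalised by their
Gram matrix, lies in the polar of the spectrahedron of `A` (`exists_mem_polar_compression`). A
vector of `H ⊗ K` involves only finitely many vectors of each factor, and the algebraic tensor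
product is dense, so positivity for all `C`, `D` gives positivity of the operator pencil.

From operators to matrices: if `N₀ ⊗ I + ∑ Nᵢ ⊗ Aᵢ` is positive, so is `N₀ ⊗ 1 + ∑ Nᵢ ⊗ Cᵢ` for `C`
in the polar (`posSemidef_add_sum_kronecker`). Boundedness of level one forces `N₀ ≥ 0`; after
adding `ε` and normalising `N₀` to `1`, this is the definition of the polar. The two tensor factors
are replaced one after the other.

At level one, testing on elementary tensors separates the variables: the suprema of the two
normalised forms add up to at most `1`, which yields the weights of a convex combination
(`append_mem_convexDirectSum`). -/

/-! ### Free spectrahedra through quadratic forms -/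

theorem isSymmetric_mapL {S : H →L[ℂ] H} {T : K →L[ℂ] K}
    (hS : (S : H →ₗ[ℂ] H).IsSymmetric) (hT : (T : K →ₗ[ℂ] K).IsSymmetric) :
    (TensorProduct.mapL S T : (H ⊗[ℂ] K) →ₗ[ℂ] (H ⊗[ℂ] K)).IsSymmetric := by
  intro x y
  induction x with
  | zero => simp
  | add x₁ x₂ h₁ h₂ => simp only [map_add, inner_add_left, h₁, h₂]
  | tmul a b =>
    induction y with
    | zero => simp
    | add y₁ y₂ h₁ h₂ => simp only [map_add, inner_add_right, h₁, h₂]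
    | tmul c d =>
      have h1 := hS a c
      have h2 := hT b d
      simp only [ContinuousLinearMap.coe_coe] at h1 h2 ⊢
      simp only [TensorProduct.mapL_tmul, TensorProduct.inner_tmul, h1, h2]

theorem isSelfAdjoint_opTensor {S : H →L[ℂ] H} {T : K →L[ℂ] K}
    (hS : (S : H →ₗ[ℂ] H).IsSymmetric) (hT : (T : K →ₗ[ℂ] K).IsSymmetric) :
    IsSelfAdjoint (opTensor S T) := by
  rw [ContinuousLinearMap.isSelfAdjoint_iff_isSymmetric]
  intro x y
  induction x, y using UniformSpace.Completion.induction_on₂ with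
  | hp => exact isClosed_eq (by fun_prop) (by fun_prop)
  | ih x y =>
    simp only [ContinuousLinearMap.coe_coe, opTensor_coe, UniformSpace.Completion.inner_coe]
    exact isSymmetric_mapL hS hT x y

theorem exists_tensor_euclidean {n : ℕ} (x : H ⊗[ℂ] EuclideanSpace ℂ (Fin n)) :
    ∃ v : Fin n → H, x = ∑ p, v p ⊗ₜ[ℂ] EuclideanSpace.single p (1 : ℂ) := by
  induction x with
  | zero => exact ⟨0, by simp⟩
  | add x y hx hy =>
    obtain ⟨v, rfl⟩ := hx
    obtain ⟨w, rfl⟩ := hy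
    exact ⟨v + w, by simp [TensorProduct.add_tmul, Finset.sum_add_distrib]⟩
  | tmul a b =>
    refine ⟨fun p => b p • a, ?_⟩
    simp_rw [TensorProduct.smul_tmul, ← TensorProduct.tmul_sum]
    congr 1
    ext q
    simp [Pi.single_apply]

theorem inner_sum_single {n : ℕ} (v : Fin n → H) (T : H →L[ℂ] H)
    (Y : Matrix (Fin n) (Fin n) ℂ) :
    ⟪∑ p, v p ⊗ₜ[ℂ] EuclideanSpace.single p (1 : ℂ),
      TensorProduct.mapL T (Matrix.toEuclideanCLM (n := Fin n) (𝕜 := ℂ) Y)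
        (∑ p, v p ⊗ₜ[ℂ] EuclideanSpace.single p (1 : ℂ))⟫_ℂ =
      ∑ p, ∑ q, Y p q * ⟪v p, T (v q)⟫_ℂ := by
  have h : ∀ p q, ⟪EuclideanSpace.single p (1 : ℂ),
      Matrix.toEuclideanCLM (n := Fin n) (𝕜 := ℂ) Y (EuclideanSpace.single q (1 : ℂ))⟫_ℂ
      = Y p q := by
    intro p q
    rw [EuclideanSpace.inner_single_left]
    simp
  simp only [map_sum, TensorProduct.mapL_tmul, sum_inner, inner_sum, TensorProduct.inner_tmul, h]
  rw [Finset.sum_comm]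
  exact Finset.sum_congr rfl fun _ _ => Finset.sum_congr rfl fun _ _ => mul_comm _ _

/-- Every vector of `H ⊗ ℂⁿ` is `∑ v p ⊗ e_p`, so the Loewner inequality becomes a scalar inequality
in `n` vectors of `H`. In this form it passes to dense subspaces and through matrix congruences. -/
theorem mem_freeSpectrahedron_iff {g : ℕ} {A : Fin g → H →L[ℂ] H}
    (hA : ∀ i, (A i : H →ₗ[ℂ] H).IsSymmetric) {n : ℕ+}
    {Y : Fin g → Matrix (Fin n) (Fin n) ℂ} :
    Y ∈ (freeSpectrahedron A).level n ↔ (∀ i, (Y i).IsHermitian) ∧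
      ∀ v : Fin n → H,
        (∑ i, ∑ p, ∑ q, Y i p q * ⟪v p, A i (v q)⟫_ℂ).re ≤ ∑ p, ‖v p‖ ^ 2 := by
  refine and_congr_right fun hY => ?_
  have hsym : ∀ i, (TensorProduct.mapL (A i)
      (Matrix.toEuclideanCLM (n := Fin n) (𝕜 := ℂ) (Y i)) :
        (H ⊗[ℂ] EuclideanSpace ℂ (Fin n)) →ₗ[ℂ] _).IsSymmetric := fun i =>
    isSymmetric_mapL (hA i) (Matrix.isSymmetric_toEuclideanLin_iff.2 (hY i))
  have hs : ((ContinuousLinearMap.id ℂ (H ⊗[ℂ] EuclideanSpace ℂ (Fin n)) - ∑ i,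
      TensorProduct.mapL (A i) (Matrix.toEuclideanCLM (n := Fin n) (𝕜 := ℂ) (Y i)) :
      (H ⊗[ℂ] EuclideanSpace ℂ (Fin n)) →L[ℂ] _) :
        (H ⊗[ℂ] EuclideanSpace ℂ (Fin n)) →ₗ[ℂ] _).IsSymmetric := by
    intro x y
    simp only [ContinuousLinearMap.coe_coe, sub_apply,
      sum_apply, ContinuousLinearMap.id_apply, inner_sub_left, inner_sub_right,
      sum_inner, inner_sum]
    congr 1
    exact Finset.sum_congr rfl fun i _ => hsym i x y
  have hval : ∀ v : Fin n → H,
      (ContinuousLinearMap.id ℂ (H ⊗[ℂ] EuclideanSpace ℂ (Fin n)) - ∑ i,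
      TensorProduct.mapL (A i)
        (Matrix.toEuclideanCLM (n := Fin n) (𝕜 := ℂ) (Y i))).reApplyInnerSelf
        (∑ p, v p ⊗ₜ[ℂ] EuclideanSpace.single p (1 : ℂ)) =
      ∑ p, ‖v p‖ ^ 2 - (∑ i, ∑ p, ∑ q, Y i p q * ⟪v p, A i (v q)⟫_ℂ).re := by
    intro v
    have h1 := inner_sum_single v (ContinuousLinearMap.id ℂ H) (1 : Matrix (Fin n) (Fin n) ℂ)
    rw [map_one, ContinuousLinearMap.one_def, TensorProduct.mapL_id_id] at h1
    rw [ContinuousLinearMap.reApplyInnerSelf_apply, ← ContinuousLinearMap.coe_coe, hs]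
    simp only [ContinuousLinearMap.coe_coe, sub_apply,
      sum_apply, inner_sub_right, inner_sum, inner_sum_single, h1]
    rw [map_sub]
    congr 1
    simp only [Matrix.one_apply, ite_mul, one_mul, zero_mul, Finset.sum_ite_eq, Finset.mem_univ,
      if_true, ContinuousLinearMap.id_apply, map_sum]
    exact Finset.sum_congr rfl fun p _ => (norm_sq_eq_re_inner (𝕜 := ℂ) (v p)).symm
  rw [ContinuousLinearMap.le_def, ContinuousLinearMap.isPositive_def]
  constructor
  · rintro ⟨-, h⟩ v
    have := h (∑ p, v p ⊗ₜ[ℂ] EuclideanSpace.single p (1 : ℂ))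
    rw [hval] at this
    linarith
  · refine fun h => ⟨hs, fun x => ?_⟩
    obtain ⟨v, rfl⟩ := exists_tensor_euclidean x
    rw [hval]
    linarith [h v]

theorem mem_levelOne_iff {g : ℕ} {A : Fin g → H →L[ℂ] H}
    (hA : ∀ i, (A i : H →ₗ[ℂ] H).IsSymmetric) {x : Fin g → ℝ} :
    x ∈ (freeSpectrahedron A).levelOne ↔
      ∀ h : H, ∑ i, x i * (⟪h, A i h⟫_ℂ).re ≤ ‖h‖ ^ 2 := by
  have hu : ∀ f : Fin ((1 : ℕ+) : ℕ) → ℝ, ∑ p, f p = f (0 : Fin 1) := fun f => Fin.sum_univ_one f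
  have hre : ∀ v : Fin ((1 : ℕ+) : ℕ) → H,
      (∑ i, ∑ p : Fin ((1 : ℕ+) : ℕ), ∑ q : Fin ((1 : ℕ+) : ℕ),
        (x i : ℂ) * ⟪v p, A i (v q)⟫_ℂ).re =
      ∑ i, x i * (⟪v (0 : Fin 1), A i (v (0 : Fin 1))⟫_ℂ).re := by
    intro v
    simp only [Complex.re_sum, Complex.re_ofReal_mul, hu]
  refine (mem_freeSpectrahedron_iff (n := 1) hA).trans
    ⟨fun h a => ?_, fun h => ⟨fun i => ?_, fun v => ?_⟩⟩
  · have h1 := h.2 fun _ => a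
    rw [hu] at h1
    exact (hre fun _ => a).symm.trans_le h1
  · exact Matrix.IsHermitian.ext fun p q => Complex.conj_ofReal (x i)
  · rw [hu]
    exact (hre v).trans_le (h (v (0 : Fin 1)))

/-! ### Compressions, congruences and regularisation -/

variable {α β κ : Type*} [Fintype α] [Fintype β] [Fintype κ]

open Matrix

/-- The compression `(⟪eₐ, T e_b⟫)` of an operator to a finite family of vectors. -/
def gramComp (e : α → H) (T : H →L[ℂ] H) : Matrix α α ℂ :=
  Matrix.of fun a b => ⟪e a, T (e b)⟫_ℂ

/-- The value `⟪v, (T ⊗ Y) v⟫` of the form of `T ⊗ Y` at a finite family of vectors. -/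
def opForm (Y : Matrix κ κ ℂ) (T : H →L[ℂ] H) (v : κ → H) : ℂ :=
  ∑ p, ∑ q, Y p q * ⟪v p, T (v q)⟫_ℂ

omit [Fintype α] in
theorem isHermitian_gramComp {T : H →L[ℂ] H} (hT : (T : H →ₗ[ℂ] H).IsSymmetric) (e : α → H) :
    (gramComp e T).IsHermitian :=
  Matrix.IsHermitian.ext fun a b => by
    have := hT (e a) (e b)
    simp only [ContinuousLinearMap.coe_coe] at this
    simp [gramComp, ← this]

theorem isSymmetric_id : ((ContinuousLinearMap.id ℂ H : H →L[ℂ] H) : H →ₗ[ℂ] H).IsSymmetric :=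
  fun _ _ => rfl

theorem posSemidef_iff_re {M : Matrix κ κ ℂ} :
    M.PosSemidef ↔ M.IsHermitian ∧ ∀ x : κ → ℂ, 0 ≤ (star x ⬝ᵥ M *ᵥ x).re := by
  rw [Matrix.posSemidef_iff_dotProduct_mulVec]
  refine and_congr_right fun hM => forall_congr' fun x => ?_
  rw [Complex.le_def]
  have := hM.im_star_dotProduct_mulVec_self x
  simp only [RCLike.im_to_complex] at this
  simp [this]

theorem isClosed_setOf_posSemidef : IsClosed {M : Matrix κ κ ℂ | M.PosSemidef} := by
  simp only [posSemidef_iff_re, Matrix.IsHermitian]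
  refine (isClosed_eq (by fun_prop) (by fun_prop)).inter ?_
  have : {M : Matrix κ κ ℂ | ∀ x : κ → ℂ, 0 ≤ (star x ⬝ᵥ M *ᵥ x).re} =
      ⋂ x : κ → ℂ, {M | 0 ≤ (star x ⬝ᵥ M *ᵥ x).re} := by ext; simp
  change IsClosed {M : Matrix κ κ ℂ | ∀ x : κ → ℂ, 0 ≤ (star x ⬝ᵥ M *ᵥ x).re}
  rw [this]
  exact isClosed_iInter fun x => isClosed_le (by fun_prop) (by fun_prop)

theorem posSemidef_of_forall_pos {f : ℝ → Matrix κ κ ℂ} (hf : Continuous f)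
    (h : ∀ ε > 0, (f ε).PosSemidef) : (f 0).PosSemidef := by
  refine isClosed_setOf_posSemidef.mem_of_tendsto
    ((hf.tendsto 0).mono_left (nhdsWithin_le_nhds (s := Set.Ioi 0))) ?_
  filter_upwards [self_mem_nhdsWithin] with ε hε using h ε hε

/-- `M` may be singular; adding `ε` makes it strictly positive, and congruence by `R` then
normalises it to `1`. The limit `ε → 0` is taken by `posSemidef_of_forall_pos`. -/
theorem exists_conjTranspose_mul_self [DecidableEq κ] {M : Matrix κ κ ℂ} (hM : M.PosSemidef)
    {ε : ℝ} (hε : 0 < ε) :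
    ∃ S R : Matrix κ κ ℂ, M + (ε : ℂ) • 1 = Sᴴ * S ∧ R * S = 1 ∧ S * R = 1 := by
  have hp : (M + (ε : ℂ) • (1 : Matrix κ κ ℂ)).PosDef :=
    Matrix.PosDef.posSemidef_add hM (Matrix.PosDef.one.smul (by exact_mod_cast hε))
  open scoped MatrixOrder Matrix.Norms.L2Operator in
  rw [← Matrix.isStrictlyPositive_iff_posDef,
    CStarAlgebra.isStrictlyPositive_iff_eq_star_mul_self] at hp
  obtain ⟨S, hS, h⟩ := hp
  obtain ⟨u, rfl⟩ := hS
  exact ⟨u, ↑u⁻¹, h, u.inv_mul, u.mul_inv⟩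

theorem kronecker_congr {α' β' : Type*} [Fintype α'] [Fintype β'] (S : Matrix α α' ℂ)
    (T : Matrix β β' ℂ) (M : Matrix α α ℂ) (N : Matrix β β ℂ) :
    (S ⊗ₖ T)ᴴ * (M ⊗ₖ N) * (S ⊗ₖ T) = (Sᴴ * M * S) ⊗ₖ (Tᴴ * N * T) := by
  rw [Matrix.conjTranspose_kronecker, ← Matrix.mul_kronecker_mul, ← Matrix.mul_kronecker_mul]

theorem opForm_sum_smul (f : κ → α → ℂ) (e : α → H) (T : H →L[ℂ] H) (Y : Matrix κ κ ℂ) :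
    opForm Y T (fun p => ∑ a, f p a • e a) =
      ∑ p, ∑ q, ∑ a, ∑ b, star (f p a) * Y p q * ⟪e a, T (e b)⟫_ℂ * f q b := by
  simp only [opForm, map_sum, map_smul, sum_inner, inner_sum, inner_smul_left, inner_smul_right,
    Finset.mul_sum]
  refine Finset.sum_congr rfl fun p _ => Finset.sum_congr rfl fun q _ => ?_
  rw [Finset.sum_comm]
  refine Finset.sum_congr rfl fun a _ => Finset.sum_congr rfl fun b _ => ?_
  rw [← starRingEnd_apply]
  ring

theorem opForm_gramComp_left (e : α → H) (T : H →L[ℂ] H) (Y : Matrix κ κ ℂ) (ξ : α × κ → ℂ) :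
    star ξ ⬝ᵥ (gramComp e T ⊗ₖ Y) *ᵥ ξ = opForm Y T fun p => ∑ a, ξ (a, p) • e a := by
  rw [opForm_sum_smul (fun p a => ξ (a, p))]
  simp only [dotProduct, mulVec, Fintype.sum_prod_type, Finset.mul_sum, gramComp,
    Matrix.kroneckerMap_apply, Matrix.of_apply, Pi.star_apply]
  rw [Finset.sum_comm]
  refine Finset.sum_congr rfl fun p _ => ?_
  simp_rw [Finset.sum_comm (s := (Finset.univ : Finset α)) (t := (Finset.univ : Finset κ))]
  refine Finset.sum_congr rfl fun q _ => Finset.sum_congr rfl fun a _ =>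
    Finset.sum_congr rfl fun b _ => ?_
  ring

theorem opForm_gramComp_right (e : α → H) (T : H →L[ℂ] H) (Y : Matrix κ κ ℂ) (ξ : κ × α → ℂ) :
    star ξ ⬝ᵥ (Y ⊗ₖ gramComp e T) *ᵥ ξ = opForm Y T fun p => ∑ a, ξ (p, a) • e a := by
  rw [opForm_sum_smul (fun p a => ξ (p, a))]
  simp only [dotProduct, mulVec, Fintype.sum_prod_type, Finset.mul_sum, gramComp,
    Matrix.kroneckerMap_apply, Matrix.of_apply, Pi.star_apply]
  refine Finset.sum_congr rfl fun p _ => ?_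
  rw [Finset.sum_comm]
  refine Finset.sum_congr rfl fun q _ => Finset.sum_congr rfl fun a _ =>
    Finset.sum_congr rfl fun b _ => ?_
  ring

/-- A congruence of the coefficients is a linear substitution of the test vectors, so an inequality
valid for all vectors survives it. -/
theorem opForm_congr (S : Matrix α κ ℂ) (Y : Matrix α α ℂ) (T : H →L[ℂ] H) (v : κ → H) :
    opForm (Sᴴ * Y * S) T v = opForm Y T fun a => ∑ p, S a p • v p := by
  rw [opForm_sum_smul (fun a p => S a p)]
  simp only [opForm, Matrix.mul_apply, Matrix.conjTranspose_apply, Finset.sum_mul]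
  have h : ∀ F : α → α → κ → κ → ℂ, ∑ a, ∑ b, ∑ p, ∑ q, F a b p q =
      ∑ p, ∑ q, ∑ b, ∑ a, F a b p q := fun F => by
    calc _ = ∑ a, ∑ p, ∑ q, ∑ b, F a b p q := by
          refine Finset.sum_congr rfl fun a _ => ?_
          rw [Finset.sum_comm]
          exact Finset.sum_congr rfl fun p _ => Finset.sum_comm
      _ = ∑ p, ∑ q, ∑ a, ∑ b, F a b p q := by
          rw [Finset.sum_comm]
          exact Finset.sum_congr rfl fun p _ => Finset.sum_comm
      _ = _ := Finset.sum_congr rfl fun p _ => Finset.sum_congr rfl fun q _ => Finset.sum_comm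
  rw [h]
  refine Finset.sum_congr rfl fun p _ => Finset.sum_congr rfl fun q _ =>
    Finset.sum_congr rfl fun a _ => Finset.sum_congr rfl fun b _ => ?_
  ring

theorem opForm_one [DecidableEq κ] (v : κ → H) :
    opForm 1 (ContinuousLinearMap.id ℂ H) v = ((∑ p, ‖v p‖ ^ 2 : ℝ) : ℂ) := by
  simp [opForm, Matrix.one_apply, inner_self_eq_norm_sq_to_K]

theorem opForm_neg (Y : Matrix κ κ ℂ) (T : H →L[ℂ] H) (v : κ → H) :
    opForm (-Y) T v = -opForm Y T v := by
  simp [opForm]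

theorem opForm_add (Y Z : Matrix κ κ ℂ) (T : H →L[ℂ] H) (v : κ → H) :
    opForm (Y + Z) T v = opForm Y T v + opForm Z T v := by
  simp [opForm, add_mul, Finset.sum_add_distrib]

theorem opForm_smul (c : ℂ) (Y : Matrix κ κ ℂ) (T : H →L[ℂ] H) (v : κ → H) :
    opForm (c • Y) T v = c * opForm Y T v := by
  simp [opForm, Finset.mul_sum, mul_assoc]
omit [Fintype α] [Fintype κ] in
theorem continuous_kronecker {P : ℝ → Matrix α α ℂ} {Q : ℝ → Matrix κ κ ℂ} (hP : Continuous P)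
    (hQ : Continuous Q) : Continuous fun x => P x ⊗ₖ Q x :=
  continuous_matrix fun i j => (hP.matrix_elem i.1 j.1).mul (hQ.matrix_elem i.2 j.2)

/-! ### Consequences of a bounded first level -/

theorem eq_zero_of_isBounded_levelOne {g : ℕ} {A : Fin g → H →L[ℂ] H}
    (hA : ∀ i, (A i : H →ₗ[ℂ] H).IsSymmetric)
    (hb : Bornology.IsBounded (freeSpectrahedron A).levelOne) {x : Fin g → ℝ}
    (hx : ∀ h : H, ∑ i, x i * (⟪h, A i h⟫_ℂ).re ≤ 0) : x = 0 := by
  obtain ⟨C, hC⟩ := hb.exists_norm_le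
  by_contra hne
  have hpos : 0 < ‖x‖ := norm_pos_iff.2 hne
  -- The whole ray through `x` lies in level one; this multiple has norm `|C| + 1`, beyond the bound
  -- `C`.
  have hmem : ((|C| + 1) / ‖x‖) • x ∈ (freeSpectrahedron A).levelOne := by
    rw [mem_levelOne_iff hA]
    intro h
    have h1 : ∑ i, (((|C| + 1) / ‖x‖) • x) i * (⟪h, A i h⟫_ℂ).re =
        ((|C| + 1) / ‖x‖) * ∑ i, x i * (⟪h, A i h⟫_ℂ).re := by
      rw [Finset.mul_sum]
      exact Finset.sum_congr rfl fun i _ => by simp [mul_assoc]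
    rw [h1]
    exact (mul_nonpos_of_nonneg_of_nonpos (by positivity) (hx h)).trans (by positivity)
  have := hC _ hmem
  rw [norm_smul, Real.norm_of_nonneg (by positivity), div_mul_cancel₀ _ hpos.ne'] at this
  linarith [le_abs_self C]

/-- Over the zero space all constraints are vacuous, and level one is all of `ℝ^g` with `g ≥ 1`. -/
theorem nontrivial_of_isBounded_levelOne {g : ℕ} (hg : 1 ≤ g) {A : Fin g → H →L[ℂ] H}
    (hA : ∀ i, (A i : H →ₗ[ℂ] H).IsSymmetric)
    (hb : Bornology.IsBounded (freeSpectrahedron A).levelOne) : Nontrivial H := by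
  by_contra hne
  rw [not_nontrivial_iff_subsingleton] at hne
  have := eq_zero_of_isBounded_levelOne hA hb (x := fun _ => 1)
    (fun h => by simp [Subsingleton.elim h 0])
  exact one_ne_zero (congrFun this ⟨0, hg⟩)

/-- A negative `c` would make `x` a recession direction, hence `x = 0`, and a nonzero `h`
contradicts `0 ≤ c * ‖h‖ ^ 2`. -/
theorem nonneg_of_isBounded_levelOne {g : ℕ} (hg : 1 ≤ g) {A : Fin g → H →L[ℂ] H}
    (hA : ∀ i, (A i : H →ₗ[ℂ] H).IsSymmetric)
    (hb : Bornology.IsBounded (freeSpectrahedron A).levelOne) {x : Fin g → ℝ} {c : ℝ}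
    (hx : ∀ h : H, ∑ i, x i * (⟪h, A i h⟫_ℂ).re ≤ c * ‖h‖ ^ 2) : 0 ≤ c := by
  by_contra! hc
  have h0 := eq_zero_of_isBounded_levelOne hA hb
    fun h => (hx h).trans (mul_nonpos_of_nonpos_of_nonneg hc.le (by positivity))
  have := nontrivial_of_isBounded_levelOne hg hA hb
  obtain ⟨h, hh⟩ := exists_ne (0 : H)
  have h1 := hx h
  simp only [h0, Pi.zero_apply, zero_mul, Finset.sum_const_zero] at h1
  nlinarith [norm_pos_iff.2 hh, pow_pos (norm_pos_iff.2 hh) 2]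

/-! ### Transfer of positivity from operators to the polar dual -/

/-- Membership in the polar dual of a free spectrahedron, tested on tuples of matrices with
an arbitrary finite index type. -/
theorem posSemidef_of_mem_polar [DecidableEq κ] {g : ℕ} {A : Fin g → H →L[ℂ] H}
    (hA : ∀ i, (A i : H →ₗ[ℂ] H).IsSymmetric) {m : ℕ+} {C : Fin g → Matrix (Fin m) (Fin m) ℂ}
    (hC : C ∈ (freeSpectrahedron A).polar.level m) {Y : Fin g → Matrix κ κ ℂ}
    (hY : ∀ i, (Y i).IsHermitian)
    (h : ∀ v : κ → H, (∑ i, opForm (Y i) (A i) v).re ≤ ∑ p, ‖v p‖ ^ 2) :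
    (1 - ∑ i, Y i ⊗ₖ C i).PosSemidef := by
  -- Levels start at `n = 1`, so an empty index type corresponds to no level.
  rcases isEmpty_or_nonempty κ with hκ | hκ
  · rw [Subsingleton.elim (1 - ∑ i, Y i ⊗ₖ C i) 0]
    exact Matrix.PosSemidef.zero
  let n : ℕ+ := ⟨Fintype.card κ, Fintype.card_pos⟩
  let e : κ ≃ Fin n := Fintype.equivFin κ
  have hmem : (fun i => (Y i).submatrix e.symm e.symm) ∈ (freeSpectrahedron A).level n := by
    rw [mem_freeSpectrahedron_iff hA]
    refine ⟨fun i => (hY i).submatrix _, fun v => ?_⟩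
    have := h fun p => v (e p)
    simp only [opForm] at this
    rw [← e.sum_comp fun p => ‖v p‖ ^ 2]
    convert this using 3 with i
    rw [← e.sum_comp]
    refine Finset.sum_congr rfl fun p _ => ?_
    rw [← e.sum_comp]
    simp
  have h1 := hC.2 n _ hmem
  rw [← Matrix.posSemidef_submatrix_equiv (e.prodCongr (Equiv.refl (Fin m)))] at h1
  convert h1 using 1
  ext x y
  simp [Matrix.sub_apply, Matrix.sum_apply, Matrix.one_apply, Prod.ext_iff]

omit [Fintype α] [Fintype κ] in
theorem isHermitian_kronecker {M : Matrix α α ℂ} {N : Matrix κ κ ℂ} (hM : M.IsHermitian)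
    (hN : N.IsHermitian) : (M ⊗ₖ N).IsHermitian := by
  rw [Matrix.IsHermitian, Matrix.conjTranspose_kronecker, hM.eq, hN.eq]

/-- Once `N₀ ≥ 0` is known, write `N₀ + ε = Sᴴ * S` with `R` inverse to `S`. The hypothesis says
that the tuple `-(Rᴴ * Nᵢ * R)` satisfies the inequality defining the spectrahedron of `A`; pairing
it with `C` and undoing the congruence gives the claim up to `ε`. -/
theorem posSemidef_add_sum_kronecker [DecidableEq κ] {g : ℕ} (hg : 1 ≤ g)
    {A : Fin g → H →L[ℂ] H} (hA : ∀ i, (A i : H →ₗ[ℂ] H).IsSymmetric)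
    (hb : Bornology.IsBounded (freeSpectrahedron A).levelOne)
    {m : ℕ+} {C : Fin g → Matrix (Fin m) (Fin m) ℂ}
    (hC : C ∈ (freeSpectrahedron A).polar.level m)
    {N₀ : Matrix κ κ ℂ} {N : Fin g → Matrix κ κ ℂ}
    (hN₀ : N₀.IsHermitian) (hN : ∀ i, (N i).IsHermitian)
    (h : ∀ v : κ → H, 0 ≤ (opForm N₀ (ContinuousLinearMap.id ℂ H) v +
      ∑ i, opForm (N i) (A i) v).re) :
    (N₀ ⊗ₖ 1 + ∑ i, N i ⊗ₖ C i).PosSemidef := by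
  have hpsd : N₀.PosSemidef := by
    refine posSemidef_iff_re.2 ⟨hN₀, fun x => ?_⟩
    -- On test vectors `x p • a` the hypothesis is a scalar inequality for `A` whose constant is the
    -- value of `N₀` at `x`.
    refine nonneg_of_isBounded_levelOne hg hA hb
      (x := fun i => -(star x ⬝ᵥ N i *ᵥ x).re) fun a => ?_
    have hform : ∀ (M : Matrix κ κ ℂ) (T : H →L[ℂ] H),
        opForm M T (fun p => x p • a) = (star x ⬝ᵥ M *ᵥ x) * ⟪a, T a⟫_ℂ := by
      intro M T
      simp only [opForm, map_smul, inner_smul_left, inner_smul_right, dotProduct, mulVec,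
        Finset.mul_sum, Finset.sum_mul, Pi.star_apply, starRingEnd_apply]
      exact Finset.sum_congr rfl fun p _ => Finset.sum_congr rfl fun q _ => by ring
    have hre : ∀ {M : Matrix κ κ ℂ}, M.IsHermitian → ∀ z : ℂ,
        ((star x ⬝ᵥ M *ᵥ x) * z).re = (star x ⬝ᵥ M *ᵥ x).re * z.re := by
      intro M hM z
      have := hM.im_star_dotProduct_mulVec_self x
      simp only [RCLike.im_to_complex] at this
      simp [Complex.mul_re, this]
    have h1 := h fun p => x p • a
    simp only [hform, Complex.add_re, Complex.re_sum, hre hN₀, hre (hN _)] at h1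
    have h2 : (⟪a, a⟫_ℂ).re = ‖a‖ ^ 2 := by
      rw [inner_self_eq_norm_sq_to_K]; norm_cast
    simp only [ContinuousLinearMap.id_apply, h2] at h1
    simp only [neg_mul, Finset.sum_neg_distrib]
    linarith
  have key : ∀ ε > (0 : ℝ),
      ((N₀ + (ε : ℂ) • 1) ⊗ₖ (1 : Matrix (Fin m) (Fin m) ℂ) + ∑ i, N i ⊗ₖ C i).PosSemidef := by
    intro ε hε
    obtain ⟨S, R, hS, hRS, hSR⟩ := exists_conjTranspose_mul_self hpsd hε
    have hRS' : Sᴴ * Rᴴ = 1 := by rw [← conjTranspose_mul, hRS, conjTranspose_one]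
    have hSR' : Rᴴ * Sᴴ = 1 := by rw [← conjTranspose_mul, hSR, conjTranspose_one]
    have hY : ∀ i, (-(Rᴴ * N i * R)).IsHermitian := fun i =>
      (isHermitian_conjTranspose_mul_mul R (hN i)).neg
    have h1 := posSemidef_of_mem_polar hA hC hY fun v => by
      have h2 := h fun a => ∑ p, R a p • v p
      have h3 : opForm (Rᴴ * (N₀ + (ε : ℂ) • 1) * R) (ContinuousLinearMap.id ℂ H) v =
          ((∑ p, ‖v p‖ ^ 2 : ℝ) : ℂ) := by
        rw [hS, ← mul_assoc, hSR', one_mul, hSR, opForm_one]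
      rw [opForm_congr, opForm_add, opForm_smul, opForm_one] at h3
      have h4 := congrArg Complex.re h3
      simp only [Complex.add_re, ← Complex.ofReal_mul, Complex.ofReal_re] at h4
      simp only [opForm_neg, opForm_congr, Finset.sum_neg_distrib, Complex.neg_re]
      rw [Complex.add_re] at h2
      have h5 : 0 ≤ ε * ∑ a, ‖∑ p, R a p • v p‖ ^ 2 := by positivity
      linarith
    have h2 := h1.conjTranspose_mul_mul_same (S ⊗ₖ (1 : Matrix (Fin m) (Fin m) ℂ))
    rw [← Matrix.one_kronecker_one, mul_sub, sub_mul, Finset.mul_sum, Finset.sum_mul,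
      kronecker_congr, mul_one, ← hS] at h2
    convert h2 using 1
    rw [sub_eq_add_neg, ← Finset.sum_neg_distrib]
    congr 1
    · simp
    · refine Finset.sum_congr rfl fun i _ => ?_
      rw [kronecker_congr]
      have : Sᴴ * -(Rᴴ * N i * R) * S = - N i := by
        calc Sᴴ * -(Rᴴ * N i * R) * S = -((Sᴴ * Rᴴ) * N i * (R * S)) := by noncomm_ring
          _ = -N i := by rw [hRS', hRS, one_mul, mul_one]
      rw [this]
      ext; simp
  have := posSemidef_of_forall_pos (f := fun ε : ℝ =>
    (N₀ + (ε : ℂ) • 1) ⊗ₖ (1 : Matrix (Fin m) (Fin m) ℂ) + ∑ i, N i ⊗ₖ C i)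
    ((continuous_kronecker (by fun_prop) continuous_const).add continuous_const) key
  simpa using this

/-- Replacing the compressions of `A` by an element of the polar dual of its free spectrahedron
preserves positivity of Kronecker pencils. -/
theorem posSemidef_kronecker_of_gramComp [DecidableEq κ] {g : ℕ} (hg : 1 ≤ g)
    {A : Fin g → H →L[ℂ] H} (hA : ∀ i, (A i : H →ₗ[ℂ] H).IsSymmetric)
    (hb : Bornology.IsBounded (freeSpectrahedron A).levelOne)
    {m : ℕ+} {C : Fin g → Matrix (Fin m) (Fin m) ℂ}
    (hC : C ∈ (freeSpectrahedron A).polar.level m)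
    {N₀ : Matrix κ κ ℂ} {N : Fin g → Matrix κ κ ℂ}
    (hN₀ : N₀.IsHermitian) (hN : ∀ i, (N i).IsHermitian)
    (h : ∀ e : κ → H, (gramComp e (ContinuousLinearMap.id ℂ H) ⊗ₖ N₀ +
      ∑ i, gramComp e (A i) ⊗ₖ N i).PosSemidef) :
    ((1 : Matrix (Fin m) (Fin m) ℂ) ⊗ₖ N₀ + ∑ i, C i ⊗ₖ N i).PosSemidef := by
  have h1 := posSemidef_add_sum_kronecker hg hA hb hC hN₀ hN fun v => by
    -- The compression is taken to the test vectors `v` themselves; the diagonal coefficients then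
    -- reproduce `v`.
    have h2 := (posSemidef_iff_re.1 (h v)).2 fun x => if x.1 = x.2 then 1 else 0
    rw [add_mulVec, dotProduct_add, Matrix.sum_mulVec, dotProduct_sum] at h2
    simpa only [opForm_gramComp_left, ite_smul, one_smul, zero_smul, Finset.sum_ite_eq',
      Finset.mem_univ, if_true] using h2
  rw [← Matrix.posSemidef_submatrix_equiv (Equiv.prodComm (Fin m) κ)] at h1
  convert h1 using 1
  ext x y
  simp only [Matrix.submatrix_apply, Matrix.add_apply, Matrix.sum_apply,
    Matrix.kroneckerMap_apply, Equiv.prodComm_apply, Prod.fst_swap, Prod.snd_swap, mul_comm]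
  rfl

/-! ### Pencils, the direct sum and the tensor tuple -/

/-- The Kronecker pencil `P ⊗ R ⊗ I - ∑ Cᵢ ⊗ R ⊗ Xᵢ - ∑ P ⊗ Dⱼ ⊗ X_{k₁+j}`. -/
def pencil [DecidableEq κ] {k₁ k₂ : ℕ} (X : Fin (k₁ + k₂) → Matrix κ κ ℂ)
    (P : Matrix α α ℂ) (C : Fin k₁ → Matrix α α ℂ)
    (R : Matrix β β ℂ) (D : Fin k₂ → Matrix β β ℂ) : Matrix (α × β × κ) (α × β × κ) ℂ :=
  P ⊗ₖ (R ⊗ₖ 1) - ∑ i, C i ⊗ₖ (R ⊗ₖ X (Fin.castAdd k₂ i)) -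
    ∑ j, P ⊗ₖ (D j ⊗ₖ X (Fin.natAdd k₁ j))

theorem mem_directSum_iff {k₁ k₂ : ℕ} {F : FreeSet k₁} {G : FreeSet k₂} {n : ℕ+}
    {X : Fin (k₁ + k₂) → Matrix (Fin n) (Fin n) ℂ} :
    X ∈ (F.directSum G).level n ↔ (∀ i, (X i).IsHermitian) ∧
      ∀ m : ℕ+, ∀ C ∈ F.polar.level m, ∀ D ∈ G.polar.level m, (pencil X 1 C 1 D).PosSemidef := by
  have key : ∀ (m l : ℕ+) (h : (m : ℕ) * m = l) (C : Fin k₁ → Matrix (Fin m) (Fin m) ℂ)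
      (D : Fin k₂ → Matrix (Fin m) (Fin m) ℂ),
      (1 - ∑ i, (Fin.append (fun i => kronSq h (C i) 1) (fun j => kronSq h 1 (D j)) :
        Fin (k₁ + k₂) → Matrix (Fin l) (Fin l) ℂ) i ⊗ₖ X i).PosSemidef ↔
      (pencil X 1 C 1 D).PosSemidef := by
    intro m l h C D
    let e : (Fin m × Fin m) × Fin n ≃ Fin l × Fin n :=
      (finProdFinEquiv.trans (finCongr h)).prodCongr (Equiv.refl _)
    rw [← Matrix.posSemidef_submatrix_equiv ((Equiv.prodAssoc _ _ _).symm.trans e),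
      Fin.sum_univ_add]
    simp only [Fin.append_left, Fin.append_right]
    refine Iff.of_eq (congrArg _ ?_)
    ext x y
    simp only [pencil, kronSq, e, Matrix.sub_apply, Matrix.add_apply, Matrix.sum_apply,
      submatrix_apply, kroneckerMap_apply, reindex_apply, Equiv.trans_apply,
      Equiv.prodAssoc_symm_apply, Equiv.prodCongr_apply, Prod.map, Equiv.refl_apply, Equiv.symm_apply_apply,
      Equiv.symm_trans_apply, mul_assoc, sub_sub]
    congr 1
    simp only [Matrix.one_apply, Prod.ext_iff, Equiv.apply_eq_iff_eq]
    split_ifs <;> simp_all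
  refine and_congr_right fun hX => ⟨fun h m C hC D hD => ?_, ?_⟩
  · refine (key m (m * m) rfl C D).1 (h (m * m) _ ?_)
    exact ⟨_, ⟨m, rfl, C, hC, rfl⟩, _, ⟨m, rfl, D, hD, rfl⟩, rfl⟩
  · rintro h l _ ⟨_, ⟨m, hm, C, hC, rfl⟩, _, ⟨m', hm', D, hD, rfl⟩, rfl⟩
    -- Both factors live at level `l = m²`, which determines `m`; hence `C` and `D` have the same
    -- size.
    obtain rfl : m = m' := PNat.coe_injective (Nat.mul_self_inj.1 (hm.trans hm'.symm))
    exact (key m l hm C D).2 (h m C hC D hD)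

omit [Fintype α] [Fintype β] [Fintype κ] in
theorem pencil_gramComp [DecidableEq κ] {k₁ k₂ : ℕ} (X : Fin (k₁ + k₂) → Matrix κ κ ℂ)
    (A : Fin k₁ → H →L[ℂ] H) (B : Fin k₂ → K →L[ℂ] K) (e : α → H) (f : β → K) :
    pencil X (gramComp e (ContinuousLinearMap.id ℂ H)) (fun i => gramComp e (A i))
      (gramComp f (ContinuousLinearMap.id ℂ K)) (fun j => gramComp f (B j)) =
    (gramComp (fun x : α × β => e x.1 ⊗ₜ[ℂ] f x.2) (ContinuousLinearMap.id ℂ (H ⊗[ℂ] K)) ⊗ₖ 1 -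
      ∑ i, gramComp (fun x : α × β => e x.1 ⊗ₜ[ℂ] f x.2)
        (TensorProduct.mapL (A i) (ContinuousLinearMap.id ℂ K)) ⊗ₖ X (Fin.castAdd k₂ i) -
      ∑ j, gramComp (fun x : α × β => e x.1 ⊗ₜ[ℂ] f x.2)
        (TensorProduct.mapL (ContinuousLinearMap.id ℂ H) (B j)) ⊗ₖ X (Fin.natAdd k₁ j)).submatrix
      (Equiv.prodAssoc α β κ).symm (Equiv.prodAssoc α β κ).symm := by
  ext x y
  simp only [pencil, gramComp, Matrix.sub_apply, Matrix.sum_apply, submatrix_apply,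
    kroneckerMap_apply, Matrix.of_apply, Equiv.prodAssoc_symm_apply, ContinuousLinearMap.id_apply,
    TensorProduct.mapL_tmul, TensorProduct.inner_tmul, mul_assoc]

omit [Fintype α] [Fintype β] [Fintype κ] in
theorem isHermitian_pencil [DecidableEq κ] {k₁ k₂ : ℕ} {X : Fin (k₁ + k₂) → Matrix κ κ ℂ}
    {P : Matrix α α ℂ} {C : Fin k₁ → Matrix α α ℂ} {R : Matrix β β ℂ}
    {D : Fin k₂ → Matrix β β ℂ} (hX : ∀ i, (X i).IsHermitian) (hP : P.IsHermitian)
    (hC : ∀ i, (C i).IsHermitian) (hR : R.IsHermitian) (hD : ∀ j, (D j).IsHermitian) :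
    (pencil X P C R D).IsHermitian := by
  refine ((isHermitian_kronecker hP (isHermitian_kronecker hR isHermitian_one)).sub
    (isSelfAdjoint_sum _ fun i _ => ?_)).sub (isSelfAdjoint_sum _ fun j _ => ?_)
  · exact isHermitian_kronecker (hC i) (isHermitian_kronecker hR (hX _))
  · exact isHermitian_kronecker hP (isHermitian_kronecker (hD j) (hX _))

theorem isSelfAdjoint_tensorTuple {k₁ k₂ : ℕ} {A : Fin k₁ → H →L[ℂ] H} {B : Fin k₂ → K →L[ℂ] K}
    (hA : ∀ i, (A i : H →ₗ[ℂ] H).IsSymmetric) (hB : ∀ j, (B j : K →ₗ[ℂ] K).IsSymmetric)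
    (i : Fin (k₁ + k₂)) : IsSelfAdjoint (tensorTuple A B i) := by
  unfold tensorTuple
  refine Fin.addCases (fun i => ?_) (fun j => ?_) i
  · rw [Fin.append_left]
    exact isSelfAdjoint_opTensor (hA i) isSymmetric_id
  · rw [Fin.append_right]
    exact isSelfAdjoint_opTensor isSymmetric_id (hB j)

/-- The inequality is closed in the test vectors, so by density the algebraic tensor product
suffices and the completion disappears. -/
theorem mem_freeSpectrahedron_tensorTuple_iff {k₁ k₂ : ℕ} {A : Fin k₁ → H →L[ℂ] H}
    {B : Fin k₂ → K →L[ℂ] K}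
    (hA : ∀ i, (A i : H →ₗ[ℂ] H).IsSymmetric) (hB : ∀ j, (B j : K →ₗ[ℂ] K).IsSymmetric) {n : ℕ+}
    {X : Fin (k₁ + k₂) → Matrix (Fin n) (Fin n) ℂ} :
    X ∈ (freeSpectrahedron (tensorTuple A B)).level n ↔ (∀ i, (X i).IsHermitian) ∧
      ∀ v : Fin n → H ⊗[ℂ] K, 0 ≤ (opForm 1 (ContinuousLinearMap.id ℂ (H ⊗[ℂ] K)) v -
        ∑ i, opForm (X (Fin.castAdd k₂ i))
          (TensorProduct.mapL (A i) (ContinuousLinearMap.id ℂ K)) v -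
        ∑ j, opForm (X (Fin.natAdd k₁ j))
          (TensorProduct.mapL (ContinuousLinearMap.id ℂ H) (B j)) v).re := by
  rw [mem_freeSpectrahedron_iff fun i =>
    (ContinuousLinearMap.isSelfAdjoint_iff_isSymmetric.1 (isSelfAdjoint_tensorTuple hA hB i))]
  refine and_congr_right fun hX => ?_
  have hcoe : ∀ v : Fin n → H ⊗[ℂ] K,
      ∑ i, ∑ p, ∑ q, X i p q * ⟪(v p : HilbertTensor H K), tensorTuple A B i (v q)⟫_ℂ =
        ∑ i, opForm (X (Fin.castAdd k₂ i))
          (TensorProduct.mapL (A i) (ContinuousLinearMap.id ℂ K)) v +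
        ∑ j, opForm (X (Fin.natAdd k₁ j))
          (TensorProduct.mapL (ContinuousLinearMap.id ℂ H) (B j)) v := by
    intro v
    rw [Fin.sum_univ_add]
    simp only [tensorTuple, Fin.append_left, Fin.append_right, opTensor_coe,
      UniformSpace.Completion.inner_coe, opForm]
  constructor
  · intro h v
    have := h fun p => v p
    rw [hcoe] at this
    simp only [UniformSpace.Completion.norm_coe, Complex.add_re] at this
    rw [opForm_one, Complex.sub_re, Complex.sub_re, Complex.ofReal_re]
    linarith
  · intro h v
    have hd : DenseRange (Pi.map fun (_ : Fin n) (x : H ⊗[ℂ] K) => (x : HilbertTensor H K)) :=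
      DenseRange.piMap fun _ => UniformSpace.Completion.denseRange_coe
    induction v using hd.induction_on with
    | hp => exact isClosed_le (by fun_prop) (by fun_prop)
    | ih v =>
      have := h v
      rw [opForm_one, Complex.sub_re, Complex.sub_re, Complex.ofReal_re] at this
      simp only [Pi.map_apply, hcoe, UniformSpace.Completion.norm_coe, Complex.add_re]
      linarith

theorem posSemidef_pencil_gramComp [DecidableEq κ] {k₁ k₂ : ℕ} {A : Fin k₁ → H →L[ℂ] H}
    {B : Fin k₂ → K →L[ℂ] K}
    (hA : ∀ i, (A i : H →ₗ[ℂ] H).IsSymmetric) (hB : ∀ j, (B j : K →ₗ[ℂ] K).IsSymmetric)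
    {X : Fin (k₁ + k₂) → Matrix κ κ ℂ} (hX : ∀ i, (X i).IsHermitian) {e : α → H} {f : β → K} :
    (pencil X (gramComp e (ContinuousLinearMap.id ℂ H)) (fun i => gramComp e (A i))
      (gramComp f (ContinuousLinearMap.id ℂ K)) (fun j => gramComp f (B j))).PosSemidef ↔
    ∀ ξ : (α × β) × κ → ℂ, ∀ v : κ → H ⊗[ℂ] K,
      (v = fun p => ∑ x : α × β, ξ (x, p) • e x.1 ⊗ₜ[ℂ] f x.2) →
      0 ≤ (opForm 1 (ContinuousLinearMap.id ℂ (H ⊗[ℂ] K)) v -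
        ∑ i, opForm (X (Fin.castAdd k₂ i))
          (TensorProduct.mapL (A i) (ContinuousLinearMap.id ℂ K)) v -
        ∑ j, opForm (X (Fin.natAdd k₁ j))
          (TensorProduct.mapL (ContinuousLinearMap.id ℂ H) (B j)) v).re := by
  have hH := isHermitian_pencil hX (isHermitian_gramComp isSymmetric_id e)
    (fun i => isHermitian_gramComp (hA i) e) (isHermitian_gramComp isSymmetric_id f)
    (fun j => isHermitian_gramComp (hB j) f)
  rw [pencil_gramComp] at hH ⊢
  have hH' := hH.submatrix (Equiv.prodAssoc α β κ)
  rw [submatrix_submatrix] at hH'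
  simp only [Equiv.symm_comp_self, submatrix_id_id] at hH'
  rw [Matrix.posSemidef_submatrix_equiv, posSemidef_iff_re, and_iff_right hH']
  refine forall_congr' fun ξ => ?_
  rw [forall_eq, sub_mulVec, sub_mulVec, dotProduct_sub, dotProduct_sub, Matrix.sum_mulVec,
    Matrix.sum_mulVec, dotProduct_sum, dotProduct_sum]
  simp only [opForm_gramComp_left]

/-! ### The direct sum lies in the spectrahedron -/

theorem pencil_congr [DecidableEq κ] {k₁ k₂ : ℕ} (X : Fin (k₁ + k₂) → Matrix κ κ ℂ)
    (P : Matrix α α ℂ) (C : Fin k₁ → Matrix α α ℂ) (R : Matrix β β ℂ) (D : Fin k₂ → Matrix β β ℂ)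
    (S : Matrix α α ℂ) (T : Matrix β β ℂ) :
    (S ⊗ₖ (T ⊗ₖ (1 : Matrix κ κ ℂ)))ᴴ * pencil X P C R D * (S ⊗ₖ (T ⊗ₖ (1 : Matrix κ κ ℂ))) =
      pencil X (Sᴴ * P * S) (fun i => Sᴴ * C i * S) (Tᴴ * R * T) (fun j => Tᴴ * D j * T) := by
  simp only [pencil, mul_sub, sub_mul, Finset.mul_sum, Finset.sum_mul, kronecker_congr,
    conjTranspose_one, one_mul, mul_one]

/-- For `Y` in the spectrahedron, testing on combinations of the `e a` gives `∑ Yᵢ ⊗ gramComp e Aᵢ ≤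
1 ⊗ G` with `G` the Gram matrix. Congruence by the inverse of `S` turns `G + ε` into `1`; the `ε`
allows linearly dependent `e`. -/
theorem exists_mem_polar_compression {g : ℕ} {A : Fin g → H →L[ℂ] H}
    (hA : ∀ i, (A i : H →ₗ[ℂ] H).IsSymmetric) {m : ℕ+} (e : Fin m → H) {ε : ℝ} (hε : 0 < ε) :
    ∃ S : Matrix (Fin m) (Fin m) ℂ, ∃ C ∈ (freeSpectrahedron A).polar.level m,
      gramComp e (ContinuousLinearMap.id ℂ H) + (ε : ℂ) • 1 = Sᴴ * S ∧
      ∀ i, gramComp e (A i) = Sᴴ * C i * S := by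
  have hG : (gramComp e (ContinuousLinearMap.id ℂ H)).PosSemidef := Matrix.posSemidef_gram ℂ e
  obtain ⟨S, R, hS, hRS, hSR⟩ := exists_conjTranspose_mul_self hG hε
  have hRS' : Sᴴ * Rᴴ = 1 := by rw [← conjTranspose_mul, hRS, conjTranspose_one]
  have hSR' : Rᴴ * Sᴴ = 1 := by rw [← conjTranspose_mul, hSR, conjTranspose_one]
  refine ⟨S, fun i => Rᴴ * gramComp e (A i) * R,
    ⟨fun i => isHermitian_conjTranspose_mul_mul R (isHermitian_gramComp (hA i) e),
      fun n Y hY => ?_⟩, hS, fun i => ?_⟩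
  · rw [mem_freeSpectrahedron_iff hA] at hY
    have h1 : ((1 : Matrix (Fin n) (Fin n) ℂ) ⊗ₖ gramComp e (ContinuousLinearMap.id ℂ H) -
        ∑ i, Y i ⊗ₖ gramComp e (A i)).PosSemidef := by
      refine posSemidef_iff_re.2 ⟨(isHermitian_kronecker isHermitian_one hG.1).sub
        (isSelfAdjoint_sum _ fun i _ =>
          isHermitian_kronecker (hY.1 i) (isHermitian_gramComp (hA i) e)), fun ξ => ?_⟩
      rw [sub_mulVec, dotProduct_sub, Matrix.sum_mulVec, dotProduct_sum]
      simp only [opForm_gramComp_right, opForm_one, Complex.sub_re, Complex.ofReal_re]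
      exact sub_nonneg.2 (hY.2 _)
    have h2 : ((1 : Matrix (Fin n) (Fin n) ℂ) ⊗ₖ
        ((ε : ℂ) • (1 : Matrix (Fin m) (Fin m) ℂ))).PosSemidef :=
      Matrix.PosSemidef.one.kronecker (Matrix.PosSemidef.one.smul (by exact_mod_cast hε.le))
    have h3 := (h1.add h2).conjTranspose_mul_mul_same ((1 : Matrix (Fin n) (Fin n) ℂ) ⊗ₖ R)
    rw [sub_add_eq_add_sub, ← Matrix.kronecker_add, hS, mul_sub, sub_mul, Finset.mul_sum,
      Finset.sum_mul, kronecker_congr, ← mul_assoc, hSR', one_mul, hSR] at h3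
    simpa only [kronecker_congr, conjTranspose_one, one_mul, mul_one, Matrix.one_kronecker_one]
      using h3
  · calc gramComp e (A i) = (Sᴴ * Rᴴ) * gramComp e (A i) * (R * S) := by
          rw [hRS', hRS, one_mul, mul_one]
      _ = _ := by simp only [mul_assoc]

theorem exists_finite_expansion {n : ℕ} (v : Fin n → H ⊗[ℂ] K) :
    ∃ (m : ℕ+) (e : Fin m → H) (f : Fin m → K) (ξ : (Fin m × Fin m) × Fin n → ℂ),
      v = fun p => ∑ x : Fin m × Fin m, ξ (x, p) • e x.1 ⊗ₜ[ℂ] f x.2 := by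
  classical
  choose s hs using fun p => TensorProduct.exists_finset (v p)
  -- One common list of pairs gives `e` and `f` the same length, as the direct sum requires; `(0,
  -- 0)` keeps that length positive.
  let U : Finset (H × K) := insert (0, 0) (Finset.univ.biUnion s)
  have hU : 0 < U.card := Finset.card_pos.2 ⟨_, Finset.mem_insert_self _ _⟩
  have hsub : ∀ p, s p ⊆ U := fun p x hx =>
    Finset.mem_insert_of_mem (Finset.mem_biUnion.2 ⟨p, Finset.mem_univ _, hx⟩)
  let m : ℕ+ := ⟨U.card, hU⟩
  let u : U ≃ Fin m := U.equivFin
  refine ⟨m, fun a => (u.symm a).1.1, fun b => (u.symm b).1.2,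
    fun x => if x.1.1 = x.1.2 ∧ (u.symm x.1.1).1 ∈ s x.2 then 1 else 0, ?_⟩
  funext p
  rw [Fintype.sum_prod_type]
  have h1 : ∀ a : Fin m, ∑ b : Fin m,
      (if a = b ∧ (u.symm a).1 ∈ s p then (1 : ℂ) else 0) •
        (u.symm a).1.1 ⊗ₜ[ℂ] (u.symm b).1.2 =
      if (u.symm a).1 ∈ s p then (u.symm a).1.1 ⊗ₜ[ℂ] (u.symm a).1.2 else 0 := by
    intro a
    simp only [ite_smul, one_smul, zero_smul, ite_and, Finset.sum_ite_eq, Finset.mem_univ, if_true]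
  rw [Finset.sum_congr rfl fun a _ => h1 a,
    u.symm.sum_comp fun x : U => if x.1 ∈ s p then x.1.1 ⊗ₜ[ℂ] x.1.2 else 0,
    Finset.sum_coe_sort U fun x => if x ∈ s p then x.1 ⊗ₜ[ℂ] x.2 else 0, hs p,
    Finset.sum_ite_mem, Finset.inter_eq_right.2 (hsub p)]

theorem directSum_level_subset {k₁ k₂ : ℕ} {A : Fin k₁ → H →L[ℂ] H} {B : Fin k₂ → K →L[ℂ] K}
    (hA : ∀ i, (A i : H →ₗ[ℂ] H).IsSymmetric) (hB : ∀ j, (B j : K →ₗ[ℂ] K).IsSymmetric)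
    (n : ℕ+) :
    ((freeSpectrahedron A).directSum (freeSpectrahedron B)).level n ⊆
      (freeSpectrahedron (tensorTuple A B)).level n := by
  intro X hX
  rw [mem_directSum_iff] at hX
  refine (mem_freeSpectrahedron_tensorTuple_iff hA hB).2 ⟨hX.1, fun v => ?_⟩
  obtain ⟨m, e, f, ξ, hv⟩ := exists_finite_expansion v
  refine (posSemidef_pencil_gramComp hA hB hX.1).1 ?_ ξ v hv
  have h := posSemidef_of_forall_pos (f := fun ε : ℝ =>
    pencil X (gramComp e (ContinuousLinearMap.id ℂ H) + (ε : ℂ) • 1) (fun i => gramComp e (A i))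
      (gramComp f (ContinuousLinearMap.id ℂ K) + (ε : ℂ) • 1) (fun j => gramComp f (B j))) ?_ ?_
  · simpa using h
  · have hc : ∀ M : Matrix (Fin m) (Fin m) ℂ, Continuous fun ε : ℝ => M + (ε : ℂ) • 1 :=
      fun M => by fun_prop
    refine ((continuous_kronecker (hc _) (continuous_kronecker (hc _) continuous_const)).sub
      (continuous_finsetSum _ fun i _ => ?_)).sub (continuous_finsetSum _ fun j _ => ?_)
    · exact continuous_kronecker continuous_const (continuous_kronecker (hc _) continuous_const)
    · exact continuous_kronecker (hc _) continuous_const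
  · intro ε hε
    obtain ⟨S, C, hC, hS, hSC⟩ := exists_mem_polar_compression hA e hε
    obtain ⟨T, D, hD, hT, hTD⟩ := exists_mem_polar_compression hB f hε
    have h1 := (hX.2 m C hC D hD).conjTranspose_mul_mul_same
      (S ⊗ₖ (T ⊗ₖ (1 : Matrix (Fin n) (Fin n) ℂ)))
    rw [pencil_congr, mul_one, mul_one, ← hS, ← hT] at h1
    simpa only [hSC, hTD] using h1

/-! ### The spectrahedron lies in the direct sum -/

omit [Fintype α] [Fintype β] [Fintype κ] in
theorem pencil_eq_left [DecidableEq κ] {k₁ k₂ : ℕ} (X : Fin (k₁ + k₂) → Matrix κ κ ℂ)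
    (P : Matrix α α ℂ) (C : Fin k₁ → Matrix α α ℂ) (R : Matrix β β ℂ)
    (D : Fin k₂ → Matrix β β ℂ) :
    pencil X P C R D = P ⊗ₖ (R ⊗ₖ 1 - ∑ j, D j ⊗ₖ X (Fin.natAdd k₁ j)) +
      ∑ i, C i ⊗ₖ (-(R ⊗ₖ X (Fin.castAdd k₂ i))) := by
  ext x y
  simp only [pencil, Matrix.sub_apply, Matrix.add_apply, Matrix.sum_apply, Matrix.neg_apply,
    kroneckerMap_apply, mul_sub, Finset.mul_sum, mul_neg, Finset.sum_neg_distrib]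
  ring

/-- Exchange of the first two tensor factors. -/
def prodLeftComm (α β κ : Type*) : β × α × κ ≃ α × β × κ where
  toFun x := (x.2.1, x.1, x.2.2)
  invFun x := (x.2.1, x.1, x.2.2)
  left_inv _ := rfl
  right_inv _ := rfl

omit [Fintype α] [Fintype β] [Fintype κ] in
theorem pencil_eq_right [DecidableEq κ] {k₁ k₂ : ℕ} (X : Fin (k₁ + k₂) → Matrix κ κ ℂ)
    (P : Matrix α α ℂ) (C : Fin k₁ → Matrix α α ℂ) (R : Matrix β β ℂ)
    (D : Fin k₂ → Matrix β β ℂ) :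
    (pencil X P C R D).submatrix (prodLeftComm α β κ) (prodLeftComm α β κ) =
      R ⊗ₖ (P ⊗ₖ 1 - ∑ i, C i ⊗ₖ X (Fin.castAdd k₂ i)) +
      ∑ j, D j ⊗ₖ (-(P ⊗ₖ X (Fin.natAdd k₁ j))) := by
  ext x y
  simp only [pencil, Matrix.sub_apply, Matrix.add_apply, Matrix.sum_apply, Matrix.neg_apply,
    submatrix_apply, prodLeftComm, Equiv.coe_fn_mk, mul_left_comm,
    kroneckerMap_apply, mul_sub, Finset.mul_sum, mul_neg, Finset.sum_neg_distrib]
  ring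

theorem level_subset_directSum {k₁ k₂ : ℕ} (hk₁ : 1 ≤ k₁) (hk₂ : 1 ≤ k₂)
    {A : Fin k₁ → H →L[ℂ] H} {B : Fin k₂ → K →L[ℂ] K}
    (hA : ∀ i, (A i : H →ₗ[ℂ] H).IsSymmetric) (hB : ∀ j, (B j : K →ₗ[ℂ] K).IsSymmetric)
    (hbA : Bornology.IsBounded (freeSpectrahedron A).levelOne)
    (hbB : Bornology.IsBounded (freeSpectrahedron B).levelOne) (n : ℕ+) :
    (freeSpectrahedron (tensorTuple A B)).level n ⊆
      ((freeSpectrahedron A).directSum (freeSpectrahedron B)).level n := by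
  intro X hX
  rw [mem_freeSpectrahedron_tensorTuple_iff hA hB] at hX
  refine mem_directSum_iff.2 ⟨hX.1, fun m C hC D hD => ?_⟩
  have hXA : ∀ i, (X (Fin.castAdd k₂ i)).IsHermitian := fun i => hX.1 _
  have hXB : ∀ j, (X (Fin.natAdd k₁ j)).IsHermitian := fun j => hX.1 _
  -- First exchange `B` for `D`, with `A` still present through arbitrary compressions. The index
  -- `Fin m × Fin n` is the coefficient size needed when `A` is exchanged for `C` next.
  have h1 : ∀ e : Fin m × Fin n → H,
      (pencil X (gramComp e (ContinuousLinearMap.id ℂ H)) (fun i => gramComp e (A i))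
        (1 : Matrix (Fin m) (Fin m) ℂ) D).PosSemidef := by
    intro e
    have hP := isHermitian_gramComp (isSymmetric_id (H := H)) e
    have h2 := posSemidef_kronecker_of_gramComp hk₂ hB hbB hD
      (N₀ := gramComp e (ContinuousLinearMap.id ℂ H) ⊗ₖ 1 -
        ∑ i, gramComp e (A i) ⊗ₖ X (Fin.castAdd k₂ i))
      (N := fun j => -(gramComp e (ContinuousLinearMap.id ℂ H) ⊗ₖ X (Fin.natAdd k₁ j)))
      ((isHermitian_kronecker hP isHermitian_one).sub (isSelfAdjoint_sum _ fun i _ =>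
        isHermitian_kronecker (isHermitian_gramComp (hA i) e) (hXA i)))
      (fun j => (isHermitian_kronecker hP (hXB j)).neg) fun f => by
        rw [← pencil_eq_right, Matrix.posSemidef_submatrix_equiv]
        exact (posSemidef_pencil_gramComp hA hB hX.1).2 fun _ v _ => hX.2 v
    rwa [← pencil_eq_right, Matrix.posSemidef_submatrix_equiv] at h2
  have h2 := posSemidef_kronecker_of_gramComp hk₁ hA hbA hC
    (N₀ := (1 : Matrix (Fin m) (Fin m) ℂ) ⊗ₖ 1 - ∑ j, D j ⊗ₖ X (Fin.natAdd k₁ j))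
    (N := fun i => -((1 : Matrix (Fin m) (Fin m) ℂ) ⊗ₖ X (Fin.castAdd k₂ i)))
    ((isHermitian_kronecker isHermitian_one isHermitian_one).sub (isSelfAdjoint_sum _ fun j _ =>
        isHermitian_kronecker (hD.1 j) (hXB j)))
    (fun i => (isHermitian_kronecker isHermitian_one (hXA i)).neg) fun e => by
      rw [← pencil_eq_left]
      exact h1 e
  rwa [← pencil_eq_left] at h2

/-! ### Level one -/

theorem convex_levelOne {g : ℕ} {A : Fin g → H →L[ℂ] H}
    (hA : ∀ i, (A i : H →ₗ[ℂ] H).IsSymmetric) : Convex ℝ (freeSpectrahedron A).levelOne := by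
  intro x hx y hy a b ha hb hab
  rw [mem_levelOne_iff hA] at hx hy ⊢
  intro h
  have h1 : ∑ i, (a • x + b • y) i * (⟪h, A i h⟫_ℂ).re =
      a * ∑ i, x i * (⟪h, A i h⟫_ℂ).re + b * ∑ i, y i * (⟪h, A i h⟫_ℂ).re := by
    simp only [Pi.add_apply, Pi.smul_apply, smul_eq_mul, add_mul, Finset.sum_add_distrib,
      Finset.mul_sum, mul_assoc]
  rw [h1]
  calc _ ≤ a * ‖h‖ ^ 2 + b * ‖h‖ ^ 2 :=
        add_le_add (mul_le_mul_of_nonneg_left (hx h) ha) (mul_le_mul_of_nonneg_left (hy h) hb)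
    _ = ‖h‖ ^ 2 := by rw [← add_mul, hab, one_mul]

theorem smul_mem_levelOne {g : ℕ} {A : Fin g → H →L[ℂ] H}
    (hA : ∀ i, (A i : H →ₗ[ℂ] H).IsSymmetric) {x : Fin g → ℝ} {s : ℝ} (hs : 0 < s)
    (h : ∀ a : H, ∑ i, x i * (⟪a, A i a⟫_ℂ).re ≤ s * ‖a‖ ^ 2) :
    s⁻¹ • x ∈ (freeSpectrahedron A).levelOne := by
  rw [mem_levelOne_iff hA]
  intro a
  have h1 : ∑ i, (s⁻¹ • x) i * (⟪a, A i a⟫_ℂ).re = s⁻¹ * ∑ i, x i * (⟪a, A i a⟫_ℂ).re := by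
    simp only [Pi.smul_apply, smul_eq_mul, Finset.mul_sum, mul_assoc]
  rw [h1, inv_mul_le_iff₀ hs]
  exact h a

/-- With zero in the second block the `D` terms vanish, and the pencil is the polar inequality for
`C` tensored with an identity. -/
theorem posSemidef_pencil_append_left {κ α β : Type*} [Fintype κ] [Fintype α] [Fintype β]
    [DecidableEq κ] [DecidableEq α] [DecidableEq β] [Subsingleton κ] {k₁ k₂ : ℕ} {x : Fin k₁ → ℝ}
    (C : Fin k₁ → Matrix α α ℂ) (D : Fin k₂ → Matrix β β ℂ)
    (h : (1 - ∑ i, (Matrix.of fun _ _ : κ => (x i : ℂ)) ⊗ₖ C i).PosSemidef) :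
    (pencil (fun i => Matrix.of fun _ _ : κ => ((Fin.append x 0 : Fin (k₁ + k₂) → ℝ) i : ℂ))
      1 C 1 D).PosSemidef := by
  let σ : α × β × κ ≃ (κ × α) × β :=
    ⟨fun y => ((y.2.2, y.1), y.2.1), fun y => (y.1.2, y.2, y.1.1), fun _ => rfl, fun _ => rfl⟩
  have h1 : pencil (fun i => Matrix.of fun _ _ : κ => ((Fin.append x 0 : Fin (k₁ + k₂) → ℝ) i : ℂ))
      1 C 1 D = ((1 - ∑ i, (Matrix.of fun _ _ : κ => (x i : ℂ)) ⊗ₖ C i) ⊗ₖ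
        (1 : Matrix β β ℂ)).submatrix σ σ := by
    ext p q
    have hs : p.2.2 = q.2.2 := Subsingleton.elim _ _
    simp only [pencil, Matrix.sub_apply, Matrix.sum_apply, submatrix_apply, kroneckerMap_apply,
      σ, Equiv.coe_fn_mk, Fin.append_left, Fin.append_right, Matrix.of_apply, Matrix.one_apply,
      Prod.ext_iff, hs, sub_mul, Finset.sum_mul, Pi.zero_apply, Complex.ofReal_zero, mul_zero,
      Finset.sum_const_zero, sub_zero, true_and, if_true, mul_one]
    congr 1
    exact Finset.sum_congr rfl fun i _ => by ring
  rw [h1, Matrix.posSemidef_submatrix_equiv]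
  exact Matrix.PosSemidef.kronecker h Matrix.PosSemidef.one

theorem posSemidef_pencil_append_right {κ α β : Type*} [Fintype κ] [Fintype α] [Fintype β]
    [DecidableEq κ] [DecidableEq α] [DecidableEq β] [Subsingleton κ] {k₁ k₂ : ℕ} {y : Fin k₂ → ℝ}
    (C : Fin k₁ → Matrix α α ℂ) (D : Fin k₂ → Matrix β β ℂ)
    (h : (1 - ∑ i, (Matrix.of fun _ _ : κ => (y i : ℂ)) ⊗ₖ D i).PosSemidef) :
    (pencil (fun i => Matrix.of fun _ _ : κ => ((Fin.append 0 y : Fin (k₁ + k₂) → ℝ) i : ℂ))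
      1 C 1 D).PosSemidef := by
  let σ : α × β × κ ≃ (κ × β) × α :=
    ⟨fun y => ((y.2.2, y.2.1), y.1), fun y => (y.2, y.1.2, y.1.1), fun _ => rfl, fun _ => rfl⟩
  have h1 : pencil (fun i => Matrix.of fun _ _ : κ => ((Fin.append 0 y : Fin (k₁ + k₂) → ℝ) i : ℂ))
      1 C 1 D = ((1 - ∑ i, (Matrix.of fun _ _ : κ => (y i : ℂ)) ⊗ₖ D i) ⊗ₖ
        (1 : Matrix α α ℂ)).submatrix σ σ := by
    ext p q
    have hs : p.2.2 = q.2.2 := Subsingleton.elim _ _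
    simp only [pencil, Matrix.sub_apply, Matrix.sum_apply, submatrix_apply, kroneckerMap_apply,
      σ, Equiv.coe_fn_mk, Fin.append_left, Fin.append_right, Matrix.of_apply, Matrix.one_apply,
      Prod.ext_iff, hs, sub_mul, Finset.sum_mul, Pi.zero_apply, Complex.ofReal_zero, mul_zero,
      Finset.sum_const_zero, sub_zero, true_and, if_true, mul_one]
    congr 1
    · exact mul_comm _ _
    · exact Finset.sum_congr rfl fun i _ => by ring
  rw [h1, Matrix.posSemidef_submatrix_equiv]
  exact Matrix.PosSemidef.kronecker h Matrix.PosSemidef.one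

theorem append_mem_levelOne_left {k₁ k₂ : ℕ} {F : FreeSet k₁} {G : FreeSet k₂}
    {x : Fin k₁ → ℝ} (h : x ∈ F.levelOne) : Fin.append x 0 ∈ (F.directSum G).levelOne := by
  refine mem_directSum_iff.2 ⟨fun i => Matrix.IsHermitian.ext fun _ _ => Complex.conj_ofReal _,
    fun m C hC D hD => ?_⟩
  have : Subsingleton (Fin ((1 : ℕ+) : ℕ)) := inferInstanceAs (Subsingleton (Fin 1))
  exact posSemidef_pencil_append_left C D (hC.2 1 _ h)

theorem append_mem_levelOne_right {k₁ k₂ : ℕ} {F : FreeSet k₁} {G : FreeSet k₂}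
    {y : Fin k₂ → ℝ} (h : y ∈ G.levelOne) : Fin.append 0 y ∈ (F.directSum G).levelOne := by
  refine mem_directSum_iff.2 ⟨fun i => Matrix.IsHermitian.ext fun _ _ => Complex.conj_ofReal _,
    fun m C hC D hD => ?_⟩
  have : Subsingleton (Fin ((1 : ℕ+) : ℕ)) := inferInstanceAs (Subsingleton (Fin 1))
  exact posSemidef_pencil_append_right C D (hD.2 1 _ h)

theorem append_mem_convexDirectSum {k₁ k₂ : ℕ} {A : Fin k₁ → H →L[ℂ] H}
    {B : Fin k₂ → K →L[ℂ] K} (hk₁ : 1 ≤ k₁) (hk₂ : 1 ≤ k₂)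
    (hA : ∀ i, (A i : H →ₗ[ℂ] H).IsSymmetric) (hB : ∀ j, (B j : K →ₗ[ℂ] K).IsSymmetric)
    (hbA : Bornology.IsBounded (freeSpectrahedron A).levelOne)
    (hbB : Bornology.IsBounded (freeSpectrahedron B).levelOne)
    {x : Fin k₁ → ℝ} {y : Fin k₂ → ℝ}
    (h : ∀ (a : H) (b : K), (∑ i, x i * (⟪a, A i a⟫_ℂ).re) * ‖b‖ ^ 2 +
      ‖a‖ ^ 2 * ∑ j, y j * (⟪b, B j b⟫_ℂ).re ≤ ‖a‖ ^ 2 * ‖b‖ ^ 2) :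
    Fin.append x y ∈ convexDirectSum (freeSpectrahedron A).levelOne
      (freeSpectrahedron B).levelOne := by
  have hH := nontrivial_of_isBounded_levelOne hk₁ hA hbA
  have hK := nontrivial_of_isBounded_levelOne hk₂ hB hbB
  set φ : H → ℝ := fun a => ∑ i, x i * (⟪a, A i a⟫_ℂ).re with hφ
  set ψ : K → ℝ := fun b => ∑ j, y j * (⟪b, B j b⟫_ℂ).re with hψ
  -- Dividing by `‖a‖ ^ 2 * ‖b‖ ^ 2` separates `a` from `b`; `s` is the supremum of the normalised
  -- form `φ`.
  obtain ⟨s, hs, hst⟩ : ∃ s : ℝ, (∀ a, φ a ≤ s * ‖a‖ ^ 2) ∧ ∀ b, ψ b ≤ (1 - s) * ‖b‖ ^ 2 := by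
    have hle : ∀ a ≠ 0, ∀ b ≠ 0, φ a / ‖a‖ ^ 2 ≤ 1 - ψ b / ‖b‖ ^ 2 := by
      intro a ha b hb
      have ha' : 0 < ‖a‖ ^ 2 := by positivity
      have hb' : 0 < ‖b‖ ^ 2 := by positivity
      have := h a b
      rw [le_sub_iff_add_le, div_add_div _ _ ha'.ne' hb'.ne', div_le_one (by positivity)]
      exact this
    obtain ⟨a₀, ha₀⟩ := exists_ne (0 : H)
    obtain ⟨b₀, hb₀⟩ := exists_ne (0 : K)
    let T : Set ℝ := (fun a => φ a / ‖a‖ ^ 2) '' {a | a ≠ 0}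
    have hT : BddAbove T := ⟨1 - ψ b₀ / ‖b₀‖ ^ 2, by
      rintro _ ⟨a, ha, rfl⟩
      exact hle a ha b₀ hb₀⟩
    refine ⟨sSup T, fun a => ?_, fun b => ?_⟩
    · rcases eq_or_ne a 0 with rfl | ha
      · simp [hφ]
      · have h1 := le_csSup hT ⟨a, ha, rfl⟩
        exact (div_le_iff₀ (by positivity)).1 h1
    · rcases eq_or_ne b 0 with rfl | hb
      · simp [hψ]
      · have h1 : sSup T ≤ 1 - ψ b / ‖b‖ ^ 2 := csSup_le ⟨_, a₀, ha₀, rfl⟩ (by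
          rintro _ ⟨a, ha, rfl⟩
          exact hle a ha b hb)
        exact (div_le_iff₀ (by positivity)).1 (by linarith)
  have hs0 : 0 ≤ s := nonneg_of_isBounded_levelOne hk₁ hA hbA hs
  have ht0 : 0 ≤ 1 - s := nonneg_of_isBounded_levelOne hk₂ hB hbB hst
  have h1 : 0 < s → Fin.append (s⁻¹ • x) 0 ∈ convexDirectSum (freeSpectrahedron A).levelOne
      (freeSpectrahedron B).levelOne := fun hs' =>
    subset_convexHull ℝ _ (Or.inl ⟨_, smul_mem_levelOne hA hs' hs, rfl⟩)
  have h2 : 0 < 1 - s → Fin.append 0 ((1 - s)⁻¹ • y) ∈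
      convexDirectSum (freeSpectrahedron A).levelOne (freeSpectrahedron B).levelOne := fun hs' =>
    subset_convexHull ℝ _ (Or.inr ⟨_, smul_mem_levelOne hB hs' hst, rfl⟩)
  -- At the endpoints one rescaling is impossible, but there boundedness makes the corresponding
  -- block zero.
  rcases hs0.eq_or_lt with rfl | hs'
  · have hx0 := eq_zero_of_isBounded_levelOne hA hbA (x := x) fun a => by simpa using hs a
    simpa [hx0] using h2 (by norm_num)
  rcases ht0.eq_or_lt with ht' | ht'
  · have hy0 := eq_zero_of_isBounded_levelOne hB hbB (x := y)
      fun b => by simpa [← ht'] using hst b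
    have hs1 : s = 1 := by linarith
    simpa [hy0, hs1] using h1 hs'
  · have h3 := convex_convexHull ℝ _ (h1 hs') (h2 ht') hs0 ht0 (by ring)
    have h4 : Fin.append x y = s • Fin.append (s⁻¹ • x) (0 : Fin k₂ → ℝ) +
        (1 - s) • Fin.append (0 : Fin k₁ → ℝ) ((1 - s)⁻¹ • y) := by
      funext l
      refine Fin.addCases (fun i => ?_) (fun j => ?_) l
      · simp [hs'.ne']
      · simp [ht'.ne']
    rw [h4]
    exact h3

theorem directSum_levelOne_subset {k₁ k₂ : ℕ} {A : Fin k₁ → H →L[ℂ] H}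
    {B : Fin k₂ → K →L[ℂ] K} (hk₁ : 1 ≤ k₁) (hk₂ : 1 ≤ k₂)
    (hA : ∀ i, (A i : H →ₗ[ℂ] H).IsSymmetric) (hB : ∀ j, (B j : K →ₗ[ℂ] K).IsSymmetric)
    (hbA : Bornology.IsBounded (freeSpectrahedron A).levelOne)
    (hbB : Bornology.IsBounded (freeSpectrahedron B).levelOne) :
    (freeSpectrahedron (tensorTuple A B)).levelOne ⊆
      convexDirectSum (freeSpectrahedron A).levelOne (freeSpectrahedron B).levelOne := by
  intro z hz
  rw [mem_levelOne_iff fun i =>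
    (ContinuousLinearMap.isSelfAdjoint_iff_isSymmetric.1 (isSelfAdjoint_tensorTuple hA hB i))] at hz
  rw [← Fin.append_castAdd_natAdd (f := z)]
  refine append_mem_convexDirectSum hk₁ hk₂ hA hB hbA hbB fun a b => ?_
  -- Elementary tensors suffice, since on them both forms factorise.
  have h := hz ((a ⊗ₜ[ℂ] b : H ⊗[ℂ] K) : HilbertTensor H K)
  have hsq : ∀ (w : ℂ), (w * ⟪b, b⟫_ℂ).re = w.re * ‖b‖ ^ 2 := by
    intro w
    rw [inner_self_eq_norm_sq_to_K, ← Complex.re_mul_ofReal]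
    norm_cast
  have hsq' : ∀ (w : ℂ), (⟪a, a⟫_ℂ * w).re = ‖a‖ ^ 2 * w.re := by
    intro w
    rw [inner_self_eq_norm_sq_to_K, ← Complex.re_ofReal_mul]
    norm_cast
  rw [Fin.sum_univ_add] at h
  simp only [tensorTuple, Fin.append_left, Fin.append_right, opTensor_coe,
    UniformSpace.Completion.inner_coe, UniformSpace.Completion.norm_coe, TensorProduct.mapL_tmul,
    TensorProduct.inner_tmul, TensorProduct.norm_tmul, ContinuousLinearMap.id_apply, hsq, hsq',
    mul_pow] at h
  simpa only [Finset.sum_mul, Finset.mul_sum, mul_assoc, mul_left_comm] using h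

end FreeSpectra

end

theorem mainTheorem7 {H₁ H₂ : Type*}
    [NormedAddCommGroup H₁] [InnerProductSpace ℂ H₁] [CompleteSpace H₁]
    [NormedAddCommGroup H₂] [InnerProductSpace ℂ H₂] [CompleteSpace H₂]
    {k₁ k₂ : ℕ} (hk₁ : 1 ≤ k₁) (hk₂ : 1 ≤ k₂)
    (A : Fin k₁ → H₁ →L[ℂ] H₁) (B : Fin k₂ → H₂ →L[ℂ] H₂)
    (hA : ∀ i, IsSelfAdjoint (A i)) (hB : ∀ j, IsSelfAdjoint (B j))
    (hbA : Bornology.IsBounded (FreeSpectra.freeSpectrahedron A).levelOne)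
    (hbB : Bornology.IsBounded (FreeSpectra.freeSpectrahedron B).levelOne) :
    (∀ i, IsSelfAdjoint (FreeSpectra.tensorTuple A B i)) ∧
    (FreeSpectra.freeSpectrahedron A).directSum (FreeSpectra.freeSpectrahedron B) =
      FreeSpectra.freeSpectrahedron (FreeSpectra.tensorTuple A B) ∧
    (FreeSpectra.IsPolytope (FreeSpectra.freeSpectrahedron A).levelOne →
      FreeSpectra.IsPolytope (FreeSpectra.freeSpectrahedron B).levelOne →
      ((FreeSpectra.freeSpectrahedron A).directSum (FreeSpectra.freeSpectrahedron B)).levelOne =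
        FreeSpectra.convexDirectSum (FreeSpectra.freeSpectrahedron A).levelOne
          (FreeSpectra.freeSpectrahedron B).levelOne) := by
  have hA' := fun i => ContinuousLinearMap.isSelfAdjoint_iff_isSymmetric.1 (hA i)
  have hB' := fun j => ContinuousLinearMap.isSelfAdjoint_iff_isSymmetric.1 (hB j)
  have hT := FreeSpectra.isSelfAdjoint_tensorTuple hA' hB'
  have heq : (FreeSpectra.freeSpectrahedron A).directSum (FreeSpectra.freeSpectrahedron B) =
      FreeSpectra.freeSpectrahedron (FreeSpectra.tensorTuple A B) :=
    FreeSpectra.FreeSet.ext <| funext fun n =>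
      (FreeSpectra.directSum_level_subset hA' hB' n).antisymm
        (FreeSpectra.level_subset_directSum hk₁ hk₂ hA' hB' hbA hbB n)
  refine ⟨hT, heq, fun _ _ => ?_⟩
  refine Set.Subset.antisymm ?_ (convexHull_min (Set.union_subset ?_ ?_) ?_)
  · rw [heq]
    exact FreeSpectra.directSum_levelOne_subset hk₁ hk₂ hA' hB' hbA hbB
  · rintro _ ⟨x, hx, rfl⟩
    exact FreeSpectra.append_mem_levelOne_left hx
  · rintro _ ⟨y, hy, rfl⟩
    exact FreeSpectra.append_mem_levelOne_right hy
  · rw [heq]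
    exact FreeSpectra.convex_levelOne fun i =>
      ContinuousLinearMap.isSelfAdjoint_iff_isSymmetric.1 (hT i)
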